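/- **Setting.** A *process* is a real-valued stochastic process $X_\bullet=(X_t)_{t\in[0,1]}$, on an arbitrary probability space $(\Omega,\mathcal F,\mathbb P)$, with almost surely continuous sample paths. For probability measures $P_0,P_1$ on $\mathbb R$, let $\mathcal S_{\mathrm{SL}}(P_0,P_1)$ be the class of *straight-line processes with independent endpoints*: processes with $(X_0,X_1)\sim P_0\otimes P_1$ such that 1. the conditional velocity $v(t,x)=\mathbb E[\dot X_t\mid X_t=x]$ is well defined: almost every sample path is locally absolutely continuous on $(0,1)$, with derivative $\dot X_t$; one has $\int_a^b\mathbb E|\dot X_t|\,dt<\infty$ for all $0<a\le b<1$; and $v(t,X_t)=\mathbb E[\dot X_t\mid\sigma(X_t)]$ almost surely, for almost every $t\in(0,1)$; 2. (a version of) $v$ is jointly measurable on $[0,1]\times\mathbb R$, and there is $L>0$ with $|v(t,x)-v(t,y)|\le L|x-y|$ for all $t\in[0,1]$, $x,y\in\mathbb R$; 3. the flow map $\phi$ given by $\partial_t\phi(t,x)=v(t,\phi(t,x))$, $\phi(0,x)=x$ satisfies $\partial_t^2\phi(t,x)=0$ for all $(t,x)\in[0,1]\times\mathbb R$. For $A,\alpha,\beta>0$,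 let $\mathcal C(A,\alpha,\beta)$ be the class of processes with $$\mathbb P\Big(\sup_{s,t\in[0,1],\,|t-s|\le\delta}|X_t-X_s|\ge\theta\Big)\le A\,\frac{\delta^\alpha}{\theta^\beta}\qquad\text{for all }\theta,\delta>0 .$$ **Corollary.** Let $P_0=\mathcal N(0,1)$, let $w_0,w_1>0$ with $w_0+w_1=1$, and let $A,\alpha,\beta>0$. For all means $\mu_0\ne\mu_1$ in $\mathbb R$ there is $\sigma_\star>0$ such that for all $\sigma_0,\sigma_1\in(0,\sigma_\star]$ the Gaussian mixture $$P_1=w_0\,\mathcal N(\mu_0,\sigma_0^2)+w_1\,\mathcal N(\mu_1,\sigma_1^2)$$ satisfies $$\mathcal S_{\mathrm{SL}}(P_0,P_1)\cap\mathcal C(A,\alpha,\beta)=\emptyset .$$ In particular, there exist $\mu_i\in\mathbb R$ and $\sigma_i>0$ ($i=0,1$) for which this intersection is empty. -/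

import Mathlib

open MeasureTheory ProbabilityTheory Set
open scoped ENNReal

universe u

namespace StraightLine

/-- A real-valued stochastic process `(X_t)_{t ∈ [0,1]}` with almost surely continuous sample
paths, on a probability space of its own. The time parameter is a real number, but only the
times in `[0,1]` matter. -/
structure ContProcess : Type (u + 1) where
  /-- the sample space -/
  Ω : Type u
  /-- its σ-algebra -/
  mΩ : MeasurableSpace Ω
  /-- the probability measure -/
  P : Measure Ω
  isProb : IsProbabilityMeasure P
  /-- the random variable `X_t` -/
  X : ℝ → Ω → ℝ
  measurable_X : ∀ t ∈ Icc (0 : ℝ) 1, Measurable (X t)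
  continuous_paths : ∀ᵐ ω ∂P, ContinuousOn (fun t => X t ω) (Icc 0 1)

attribute [instance] ContProcess.mΩ ContProcess.isProb

/-- The class `𝒮(P₀, P₁)`: processes with continuous sample paths and independent endpoints,
`(X_0, X_1) ∼ P₀ ⊗ P₁`. -/
def IndepEndpoints (P₀ P₁ : Measure ℝ) : Set ContProcess.{u} :=
  {S | S.P.map (fun ω => (S.X 0 ω, S.X 1 ω)) = P₀.prod P₁}

/-- The time derivative `Ẋ_t(ω)` of the sample paths. -/
noncomputable def ContProcess.velocity (S : ContProcess.{u}) (t : ℝ) (ω : S.Ω) : ℝ :=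
  deriv (fun s => S.X s ω) t

/-- `v` is (a version of) the conditional velocity field `v(t, x) = 𝔼[Ẋ_t | X_t = x]` of the
process, which is in particular well defined: the sample paths are almost surely locally absolutely
continuous on `(0,1)` (so that `Ẋ_t` is their weak derivative), the velocity `Ẋ_t(ω)` is integrable
in `(t, ω)` over every `[a,b] × Ω` with `[a,b] ⊂ (0,1)`, and `v(t, X_t) = 𝔼[Ẋ_t | σ(X_t)]` almost
surely, for almost every time `t`. The velocity is allowed to blow up at the times `0` and `1`. -/
structure IsConditionalVelocity (S : ContProcess.{u}) (v : ℝ → ℝ → ℝ) : Prop where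
  locallyAC : ∀ᵐ ω ∂S.P, ∀ a b : ℝ, 0 < a → a ≤ b → b < 1 →
    AbsolutelyContinuousOnInterval (fun t => S.X t ω) a b
  integrable : ∀ a b : ℝ, 0 < a → a ≤ b → b < 1 →
    Integrable (fun p : ℝ × S.Ω => S.velocity p.1 p.2) ((volume.restrict (Icc a b)).prod S.P)
  condExp_eq : ∀ᵐ t ∂(volume.restrict (Ioo (0 : ℝ) 1)),
    S.P[S.velocity t | MeasurableSpace.comap (S.X t) inferInstance] =ᵐ[S.P]
      fun ω => v t (S.X t ω)

/-- `φ` is the flow map of the velocity field `v` on `[0,1]`: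
`∂ₜ φ(t, x) = v(t, φ(t, x))` and `φ(0, x) = x`. -/
structure IsFlowMap (v φ : ℝ → ℝ → ℝ) : Prop where
  ode : ∀ t ∈ Icc (0 : ℝ) 1, ∀ x : ℝ,
    HasDerivWithinAt (fun s => φ s x) (v t (φ t x)) (Icc 0 1) t
  initial : ∀ x : ℝ, φ 0 x = x

/-- The class `𝒮_SL(P₀, P₁)` of straight-line processes: processes with independent endpoints whose
conditional velocity `v` is well defined, jointly measurable and Lipschitz in space uniformly in
time, and whose flow map `φ` has no acceleration, `∂ₜ² φ = 0` on `[0,1] × ℝ`. -/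
def StraightLineProcesses (P₀ P₁ : Measure ℝ) : Set ContProcess.{u} :=
  {S | S ∈ IndepEndpoints P₀ P₁ ∧ ∃ v φ : ℝ → ℝ → ℝ,
    IsConditionalVelocity S v ∧
    Measurable (fun p : Icc (0 : ℝ) 1 × ℝ => v p.1 p.2) ∧
    (∃ L : ℝ, 0 < L ∧ ∀ t ∈ Icc (0 : ℝ) 1, ∀ x y : ℝ, |v t x - v t y| ≤ L * |x - y|) ∧
    IsFlowMap v φ ∧
    ∀ t ∈ Icc (0 : ℝ) 1, ∀ x : ℝ,
      HasDerivWithinAt (fun s => derivWithin (fun r => φ r x) (Icc 0 1) s) 0 (Icc 0 1) t}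

/-- The modulus of continuity `κ_X(δ; ω) = sup {|X_t(ω) - X_s(ω)| : s, t ∈ [0,1], |t - s| ≤ δ}`,
with values in `[0, ∞]`. -/
noncomputable def ContProcess.modulus (S : ContProcess.{u}) (δ : ℝ) (ω : S.Ω) : ℝ≥0∞ :=
  ⨆ (t ∈ Icc (0 : ℝ) 1) (s ∈ Icc (0 : ℝ) 1) (_ : |t - s| ≤ δ),
    ENNReal.ofReal |S.X t ω - S.X s ω|

/-- The class `𝒞(A, α, β)`: processes with continuous sample paths such that
`ℙ(κ_X(δ) ≥ θ) ≤ A δ^α / θ^β` for all `θ, δ > 0`. -/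
def ConcentrationClass (A α β : ℝ) : Set ContProcess.{u} :=
  {S | ∀ θ δ : ℝ, 0 < θ → 0 < δ →
    S.P {ω | ENNReal.ofReal θ ≤ S.modulus δ ω} ≤ ENNReal.ofReal (A * δ ^ α / θ ^ β)}

/-- The Gaussian mixture `w₀ 𝒩(m₀, σ₀²) + w₁ 𝒩(m₁, σ₁²)`. -/
noncomputable def gaussianMixture (w₀ w₁ m₀ m₁ σ₀ σ₁ : ℝ) : Measure ℝ :=
  ENNReal.ofReal w₀ • gaussianReal m₀ (Real.toNNReal (σ₀ ^ 2)) +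
    ENNReal.ofReal w₁ • gaussianReal m₁ (Real.toNNReal (σ₁ ^ 2))

end StraightLine

namespace StraightLine

open Filter Topology
open scoped NNReal

/-! Without acceleration, the flow lines are straight lines `x + c x * t` on which `v` equals the
slope `c x`. The Lipschitz bound keeps them from meeting and makes the time-one flow map onto
(`straight_flow_lt`, `straight_flow_surjective`). It also gives `|v - c x| ≤ L * dist` near each
line, so no mass flows through the line, and the probability of being above it does not depend on
time (`measureReal_line_lt_eq`).

Consider the two lines that end at `m - d` and `m`, in the valley between the two modes. The strip
between them carries at every time the tiny mass `P₁ (m - d, m]`, while its width at time `t` is at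
least `t * d`. Since the endpoints are independent, a path starts well below the upper line and ends
above it with probability at least `q ^ 2 / 2`. The concentration bound stops most such paths from
reaching the line before a time `h`, when the strip is already wide, and from jumping over the strip
between neighbouring grid times. So they are seen inside the strip at one of `N + 1` times
(`exists_grid_time_near_line`), and a union bound contradicts the tiny mass
(`not_mem_concentrationClass`). The numbers `h` and `N` depend only on the weights, the means and
`A, α, β`, so the variances can be chosen last. -/

/-! ### Evolution of smooth observables relative to a line -/

/-- A Lipschitz function of an absolutely continuous function is absolutely continuous. -/
theorem _root_.LipschitzWith.comp_absolutelyContinuousOnInterval {g f : ℝ → ℝ} {K : ℝ≥0} {a b : ℝ}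
    (hg : LipschitzWith K g) (hf : AbsolutelyContinuousOnInterval f a b) :
    AbsolutelyContinuousOnInterval (fun t => g (f t)) a b := by
  rw [absolutelyContinuousOnInterval_iff] at hf ⊢
  intro ε hε
  obtain ⟨δ, hδ, H⟩ := hf (ε / (K + 1)) (by positivity)
  refine ⟨δ, hδ, fun E hE hlen => ?_⟩
  have h1 := H E hE hlen
  rw [lt_div_iff₀ (by positivity)] at h1
  refine lt_of_le_of_lt ?_ h1
  rw [Finset.sum_mul]
  refine Finset.sum_le_sum fun i _ => (hg.dist_le_mul _ _).trans ?_
  have : (0 : ℝ) ≤ dist (f (E.2 i).1) (f (E.2 i).2) := dist_nonneg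
  nlinarith

/-- The chain rule for a smooth function of an absolutely continuous path relative to a line, in
integrated form. -/
theorem integral_deriv_comp_sub_affine {f g : ℝ → ℝ} {K : ℝ≥0} {a b : ℝ} (p c : ℝ)
    (hg : LipschitzWith K g) (hg' : Differentiable ℝ g)
    (hf : AbsolutelyContinuousOnInterval f a b) :
    ∫ r in a..b, deriv g (f r - (p + c * r)) * (deriv f r - c) =
      g (f b - (p + c * b)) - g (f a - (p + c * a)) := by
  have hl : AbsolutelyContinuousOnInterval (fun r : ℝ => p + c * r) a b :=
    ContDiffOn.absolutelyContinuousOnInterval (by fun_prop)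
  have hz := hg.comp_absolutelyContinuousOnInterval (hf.sub hl)
  refine Eq.trans ?_ hz.integral_deriv_eq_sub
  refine intervalIntegral.integral_congr_ae ?_
  filter_upwards [hf.ae_differentiableAt] with r hr hrm
  have h1 : HasDerivAt (fun r => f r - (p + c * r)) (deriv f r - c) r := by
    have h2 : HasDerivAt (fun r : ℝ => p + c * r) c r := by
      simpa using ((hasDerivAt_id r).const_mul c).const_add p
    exact (hr (uIoc_subset_uIcc hrm)).hasDerivAt.sub h2
  exact ((hg' _).hasDerivAt.comp r h1).deriv.symm

theorem aestronglyMeasurable_uncurry (S : ContProcess.{u}) :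
    AEStronglyMeasurable (fun q : ℝ × S.Ω => S.X q.1 q.2)
      ((volume.restrict (Icc (0 : ℝ) 1)).prod S.P) := by
  classical
  obtain ⟨N, hN, hNm, hN0⟩ := exists_measurable_superset_of_null (ae_iff.1 S.continuous_paths)
  -- Clamping time to `[0,1]` and zeroing the exceptional paths makes every path continuous on all
  -- of `ℝ`, which gives joint measurability.
  let Y : ℝ → S.Ω → ℝ := fun t ω => if ω ∈ N then 0 else S.X (projIcc 0 1 zero_le_one t) ω
  have hYm : ∀ t, Measurable (Y t) := fun t =>
    Measurable.ite hNm measurable_const (S.measurable_X _ (projIcc 0 1 zero_le_one t).2)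
  have hYc : ∀ ω, Continuous fun t => Y t ω := by
    intro ω
    by_cases h : ω ∈ N
    · simp only [Y, h, if_true]; exact continuous_const
    · simp only [Y, h, if_false]
      have h1 : ContinuousOn (fun t => S.X t ω) (Icc 0 1) := by
        by_contra h2; exact h (hN h2)
      exact h1.comp_continuous (continuous_subtype_val.comp continuous_projIcc)
        fun t => (projIcc 0 1 zero_le_one t).2
  have hY := measurable_uncurry_of_continuous_of_measurable hYc hYm
  refine ⟨_, hY.stronglyMeasurable, ?_⟩
  have h1 : ∀ᵐ q ∂((volume.restrict (Icc (0 : ℝ) 1)).prod S.P), q.1 ∈ Icc (0 : ℝ) 1 :=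
    Measure.quasiMeasurePreserving_fst.ae (ae_restrict_mem measurableSet_Icc)
  have h2 : ∀ᵐ q ∂((volume.restrict (Icc (0 : ℝ) 1)).prod S.P), q.2 ∉ N :=
    Measure.quasiMeasurePreserving_snd.ae (measure_eq_zero_iff_ae_notMem.1 hN0)
  filter_upwards [h1, h2] with q hq1 hq2
  simp [Function.uncurry, Y, hq2, projIcc_of_mem zero_le_one hq1]

/-- At almost every time, testing the velocity against a function of the position amounts to
testing the conditional velocity, which is Lipschitz around the line `p + c t`. -/
theorem abs_integral_mul_velocity_sub_le {S : ContProcess.{u}} {v : ℝ → ℝ → ℝ} {L p c t C K : ℝ}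
    (ht : t ∈ Icc (0 : ℝ) 1)
    (hint : Integrable (S.velocity t) S.P)
    (hce : S.P[S.velocity t | MeasurableSpace.comap (S.X t) inferInstance] =ᵐ[S.P]
      fun ω => v t (S.X t ω))
    (hL : ∀ x, |v t x - c| ≤ L * |x - (p + c * t)|) {h : ℝ → ℝ} (hh : Continuous h)
    (hK : ∀ z, |h z| ≤ K) (hC : ∀ z, |h z * z| ≤ C) :
    |∫ ω, h (S.X t ω - (p + c * t)) * (S.velocity t ω - c) ∂S.P| ≤
      ∫ ω, L * |h (S.X t ω - (p + c * t)) * (S.X t ω - (p + c * t))| ∂S.P := by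
  have hX := S.measurable_X t ht
  have hm : MeasurableSpace.comap (S.X t) inferInstance ≤ S.mΩ := hX.comap_le
  set f : S.Ω → ℝ := fun ω => h (S.X t ω - (p + c * t)) with hf
  have hfm : StronglyMeasurable[MeasurableSpace.comap (S.X t) inferInstance] f := by
    have h1 : Measurable[MeasurableSpace.comap (S.X t) inferInstance] (S.X t) :=
      comap_measurable _
    exact Measurable.stronglyMeasurable
      ((hh.comp (continuous_id.sub continuous_const)).measurable.comp h1)
  have hfi : Integrable (fun ω => f ω * (S.velocity t ω - c)) S.P :=
    (hint.sub (integrable_const c)).bdd_mul (hfm.mono hm).aestronglyMeasurable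
      (ae_of_all _ fun ω => hK _)
  -- Tower property: `f` is a function of `X_t`, so it can be pulled out of the conditional
  -- expectation.
  have h1 : ∫ ω, f ω * (S.velocity t ω - c) ∂S.P = ∫ ω, f ω * (v t (S.X t ω) - c) ∂S.P := by
    rw [← integral_condExp hm]
    refine integral_congr_ae ?_
    have h2 := condExp_mul_of_stronglyMeasurable_left hfm (μ := S.P)
      (g := S.velocity t - fun _ => c) hfi (hint.sub (integrable_const c))
    have h3 := condExp_sub hint (integrable_const c) (μ := S.P)
      (MeasurableSpace.comap (S.X t) inferInstance)
    rw [condExp_const hm] at h3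
    filter_upwards [h2, h3, hce] with ω a1 a2 a3
    refine a1.trans ?_
    simp only [Pi.mul_apply, a2, Pi.sub_apply, a3]
  rw [h1, ← Real.norm_eq_abs]
  have hmeas : Measurable fun ω => S.X t ω - (p + c * t) := hX.sub_const _
  refine norm_integral_le_of_norm_le (Integrable.const_mul ?_ L) (ae_of_all _ fun ω => ?_)
  · refine Integrable.abs (Integrable.of_bound (C := C) ?_ (ae_of_all _ fun ω => hC _))
    exact ((hh.measurable.comp hmeas).mul hmeas).aestronglyMeasurable
  · rw [Real.norm_eq_abs, abs_mul, abs_mul]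
    have := hL (S.X t ω)
    nlinarith [abs_nonneg (f ω), mul_le_mul_of_nonneg_left this (abs_nonneg (f ω))]

theorem integrable_comp_sub_line {S : ContProcess.{u}} {p c C : ℝ} {k : ℝ → ℝ}
    (hk : Continuous k) (hC : ∀ z, |k z| ≤ C) :
    Integrable (fun q : ℝ × S.Ω => k (S.X q.1 q.2 - (p + c * q.1)))
      ((volume.restrict (Icc (0 : ℝ) 1)).prod S.P) := by
  refine Integrable.of_bound (C := C) ?_ (ae_of_all _ fun ω => hC _)
  refine hk.comp_aestronglyMeasurable ((aestronglyMeasurable_uncurry S).sub ?_)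
  exact Measurable.aestronglyMeasurable (by fun_prop)

/-- The chain rule along paths and Fubini express the increment through `deriv g * (velocity - c)`;
conditioning on the position turns the second factor into `v - c`, which is at most `L` times the
distance to the line. The times stay inside `(0,1)`, where the velocity is integrable. -/
theorem abs_integral_sub_integral_le {S : ContProcess.{u}} {v : ℝ → ℝ → ℝ} {L p c a b C M : ℝ}
    {K : ℝ≥0} (hv : IsConditionalVelocity S v) (ha : 0 < a) (hab : a ≤ b) (hb : b < 1)
    (hL0 : 0 ≤ L)
    (hL : ∀ t ∈ Icc (0 : ℝ) 1, ∀ x, |v t x - c| ≤ L * |x - (p + c * t)|) {g : ℝ → ℝ}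
    (hg : ContDiff ℝ 1 g) (hK : LipschitzWith K g) (hM : ∀ z, |g z| ≤ M)
    (hC : ∀ z, |deriv g z * z| ≤ C) :
    |∫ ω, g (S.X b ω - (p + c * b)) ∂S.P - ∫ ω, g (S.X a ω - (p + c * a)) ∂S.P| ≤
      L * ∫ q : ℝ × S.Ω, |deriv g (S.X q.1 q.2 - (p + c * q.1)) * (S.X q.1 q.2 - (p + c * q.1))|
        ∂((volume.restrict (Icc (0 : ℝ) 1)).prod S.P) := by
  have hsub : Icc a b ⊆ Icc (0 : ℝ) 1 := Icc_subset_Icc ha.le hb.le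
  have hdc : Continuous (deriv g) := hg.continuous_deriv le_rfl
  have hdK : ∀ z, |deriv g z| ≤ K := fun z => by
    simpa using norm_deriv_le_of_lipschitz hK (x₀ := z)
  have hgi : ∀ t ∈ Icc (0 : ℝ) 1, Integrable (fun ω => g (S.X t ω - (p + c * t))) S.P := fun t ht =>
    Integrable.of_bound (C := M) ((hg.continuous.measurable.comp
      ((S.measurable_X t ht).sub_const _)).aestronglyMeasurable) (ae_of_all _ fun ω => hM _)
  have hle : (volume.restrict (Icc a b)).prod S.P ≤ (volume.restrict (Icc (0 : ℝ) 1)).prod S.P :=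
    Measure.prod_mono (Measure.restrict_mono hsub le_rfl) le_rfl
  set F : ℝ → S.Ω → ℝ := fun r ω =>
    deriv g (S.X r ω - (p + c * r)) * (S.velocity r ω - c) with hF
  have hFi : Integrable (Function.uncurry F) ((volume.restrict (Icc a b)).prod S.P) := by
    refine Integrable.bdd_mul (c := K)
      ((hv.integrable a b ha hab hb).sub (integrable_const c)) ?_ (ae_of_all _ fun q => hdK _)
    exact ((integrable_comp_sub_line hdc hdK).mono_measure hle).aestronglyMeasurable
  have hHi : Integrable (fun q : ℝ × S.Ω => L *
      |deriv g (S.X q.1 q.2 - (p + c * q.1)) * (S.X q.1 q.2 - (p + c * q.1))|)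
        ((volume.restrict (Icc (0 : ℝ) 1)).prod S.P) :=
    (integrable_comp_sub_line (k := fun z => deriv g z * z) (hdc.mul continuous_id) hC).abs.const_mul L
  have h1 : ∫ ω, g (S.X b ω - (p + c * b)) ∂S.P - ∫ ω, g (S.X a ω - (p + c * a)) ∂S.P =
      ∫ r in Icc a b, ∫ ω, F r ω ∂S.P := by
    rw [integral_integral_swap hFi, ← integral_sub (hgi b (hsub ⟨hab, le_rfl⟩))
      (hgi a (hsub ⟨le_rfl, hab⟩))]
    refine integral_congr_ae ?_
    filter_upwards [hv.locallyAC] with ω hω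
    rw [integral_Icc_eq_integral_Ioc, ← intervalIntegral.integral_of_le hab]
    exact (integral_deriv_comp_sub_affine p c hK (hg.differentiable one_ne_zero)
      (hω a b ha hab hb)).symm
  rw [h1, ← integral_const_mul]
  calc |∫ r in Icc a b, ∫ ω, F r ω ∂S.P|
      ≤ ∫ r in Icc a b, ∫ ω, L *
        |deriv g (S.X r ω - (p + c * r)) * (S.X r ω - (p + c * r))| ∂S.P := by
        rw [← Real.norm_eq_abs]
        refine norm_integral_le_of_norm_le (hHi.mono_measure hle).integral_prod_left ?_
        have h3 := ae_restrict_of_ae_restrict_of_subset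
          (fun t (ht : t ∈ Icc a b) => (⟨ha.trans_le ht.1, ht.2.trans_lt hb⟩ : t ∈ Ioo (0 : ℝ) 1))
          hv.condExp_eq
        filter_upwards [h3, (hv.integrable a b ha hab hb).prod_right_ae,
          ae_restrict_mem measurableSet_Icc] with r hr1 hr2 hr3
        exact abs_integral_mul_velocity_sub_le (hsub hr3) hr2 hr1 (hL r (hsub hr3)) hdc hdK hC
    _ = ∫ q : ℝ × S.Ω, L *
        |deriv g (S.X q.1 q.2 - (p + c * q.1)) * (S.X q.1 q.2 - (p + c * q.1))|
          ∂((volume.restrict (Icc a b)).prod S.P) := (integral_prod _ (hHi.mono_measure hle)).symm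
    _ ≤ _ := integral_mono_measure hle (ae_of_all _ fun q => by positivity) hHi

/-- The previous estimate up to the endpoints of the time interval. -/
theorem abs_integral_sub_integral_le_of_mem_Icc {S : ContProcess.{u}} {v : ℝ → ℝ → ℝ}
    {L p c s t C M : ℝ} {K : ℝ≥0} (hv : IsConditionalVelocity S v) (hs : s ∈ Icc (0 : ℝ) 1)
    (ht : t ∈ Icc (0 : ℝ) 1) (hL0 : 0 ≤ L)
    (hL : ∀ t ∈ Icc (0 : ℝ) 1, ∀ x, |v t x - c| ≤ L * |x - (p + c * t)|) {g : ℝ → ℝ}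
    (hg : ContDiff ℝ 1 g) (hK : LipschitzWith K g) (hM : ∀ z, |g z| ≤ M)
    (hC : ∀ z, |deriv g z * z| ≤ C) :
    |∫ ω, g (S.X t ω - (p + c * t)) ∂S.P - ∫ ω, g (S.X s ω - (p + c * s)) ∂S.P| ≤
      L * ∫ q : ℝ × S.Ω, |deriv g (S.X q.1 q.2 - (p + c * q.1)) * (S.X q.1 q.2 - (p + c * q.1))|
        ∂((volume.restrict (Icc (0 : ℝ) 1)).prod S.P) := by
  set B := L * ∫ q : ℝ × S.Ω,
    |deriv g (S.X q.1 q.2 - (p + c * q.1)) * (S.X q.1 q.2 - (p + c * q.1))|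
      ∂((volume.restrict (Icc (0 : ℝ) 1)).prod S.P) with hB
  set e : ℝ → ℝ := fun t => ∫ ω, g (S.X t ω - (p + c * t)) ∂S.P with he
  -- Boundedness of `g` and path continuity suffice here, so the bound extends to times 0 and 1 even
  -- if the velocity blows up there.
  have hcont : ContinuousOn e (Icc 0 1) := by
    intro t ht
    refine tendsto_integral_filter_of_dominated_convergence (fun _ => M) ?_ ?_
      (integrable_const M) ?_
    · filter_upwards [self_mem_nhdsWithin] with r hr
      exact (hg.continuous.measurable.comp ((S.measurable_X r hr).sub_const _)).aestronglyMeasurable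
    · exact Eventually.of_forall fun r => ae_of_all _ fun ω => hM _
    · filter_upwards [S.continuous_paths] with ω hω
      exact (hg.continuous.tendsto _).comp ((hω t ht).sub
        (Continuous.continuousWithinAt (by fun_prop)))
  have hin : ∀ s ∈ Ioo (0 : ℝ) 1, ∀ t ∈ Ioo (0 : ℝ) 1, |e t - e s| ≤ B := by
    intro s hs t ht
    rcases le_total s t with h | h
    · exact abs_integral_sub_integral_le hv hs.1 h ht.2 hL0 hL hg hK hM hC
    · rw [abs_sub_comm]
      exact abs_integral_sub_integral_le hv ht.1 h hs.2 hL0 hL hg hK hM hC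
  have hcl : closure (Ioo (0 : ℝ) 1) = Icc 0 1 := closure_Ioo zero_ne_one
  have hin2 : ∀ s ∈ Ioo (0 : ℝ) 1, ∀ t ∈ Icc (0 : ℝ) 1, |e t - e s| ≤ B := by
    intro s hs t ht
    refine ContinuousWithinAt.closure_le (s := Ioo (0 : ℝ) 1) (f := fun t => |e t - e s|)
      (g := fun _ => B) (hcl ▸ ht) ?_ continuousWithinAt_const fun r hr => hin s hs r hr
    exact (((hcont t ht).mono Ioo_subset_Icc_self).sub continuousWithinAt_const).abs
  refine ContinuousWithinAt.closure_le (s := Ioo (0 : ℝ) 1) (f := fun s => |e t - e s|)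
      (g := fun _ => B) (hcl ▸ hs) ?_ continuousWithinAt_const fun r hr => hin2 r hr t ht
  exact (continuousWithinAt_const.sub ((hcont s hs).mono Ioo_subset_Icc_self)).abs

/-! ### Steep smooth steps and conservation of mass above a line -/

theorem deriv_smoothTransition_eq_zero {x : ℝ} (hx : x < 0 ∨ 1 < x) :
    deriv Real.smoothTransition x = 0 := by
  rcases hx with hx | hx
  · have : Real.smoothTransition =ᶠ[𝓝 x] fun _ => 0 := by
      filter_upwards [Iio_mem_nhds hx] with y hy
      exact Real.smoothTransition.zero_of_nonpos (le_of_lt hy)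
    rw [this.deriv_eq, deriv_const]
  · have : Real.smoothTransition =ᶠ[𝓝 x] fun _ => 1 := by
      filter_upwards [Ioi_mem_nhds hx] with y hy
      exact Real.smoothTransition.one_of_one_le (le_of_lt hy)
    rw [this.deriv_eq, deriv_const]

/-- The bound on `s'(x) * x` is invariant under dilation, so it dominates the flux terms of all the
steps `s (n * z)` at once. -/
theorem exists_bound_deriv_smoothTransition :
    ∃ C : ℝ, 0 ≤ C ∧ (∀ x, |deriv Real.smoothTransition x| ≤ C) ∧
      ∀ x, |deriv Real.smoothTransition x * x| ≤ C := by
  have hc : Continuous (deriv Real.smoothTransition) :=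
    (Real.smoothTransition.contDiff (n := 1)).continuous_deriv le_rfl
  obtain ⟨C, hC⟩ := (isCompact_Icc (a := (0 : ℝ)) (b := 1)).exists_bound_of_continuousOn
    hc.continuousOn
  have hC0 : 0 ≤ C := (norm_nonneg _).trans (hC 0 (by simp))
  refine ⟨C, hC0, fun x => ?_, fun x => ?_⟩
  · by_cases hx : x ∈ Icc (0 : ℝ) 1
    · exact hC x hx
    · rw [deriv_smoothTransition_eq_zero (by simpa [or_iff_not_imp_left] using hx), abs_zero]
      exact hC0
  · by_cases hx : x ∈ Icc (0 : ℝ) 1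
    · rw [abs_mul, abs_of_nonneg hx.1]
      exact (mul_le_of_le_one_right (abs_nonneg _) hx.2).trans (hC x hx)
    · rw [deriv_smoothTransition_eq_zero (by simpa [or_iff_not_imp_left] using hx), zero_mul,
        abs_zero]
      exact hC0

theorem deriv_smoothTransition_mul_tendsto (x : ℝ) :
    Tendsto (fun n : ℕ => |deriv Real.smoothTransition (n * x) * (n * x)|) atTop (𝓝 0) := by
  refine tendsto_const_nhds.congr' ?_
  rcases le_or_gt x 0 with hx | hx
  · filter_upwards with n
    have h1 : (n : ℝ) * x ≤ 0 := mul_nonpos_of_nonneg_of_nonpos n.cast_nonneg hx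
    rcases h1.eq_or_lt with h | h
    · simp [h]
    · simp [deriv_smoothTransition_eq_zero (Or.inl h)]
  · filter_upwards [(tendsto_natCast_atTop_atTop.atTop_mul_const hx).eventually_gt_atTop 1] with n hn
    simp [deriv_smoothTransition_eq_zero (Or.inr hn)]

theorem smoothTransition_mul_tendsto (x : ℝ) :
    Tendsto (fun n : ℕ => Real.smoothTransition (n * x)) atTop
      (𝓝 ((Ioi (0 : ℝ)).indicator 1 x)) := by
  refine tendsto_const_nhds.congr' ?_
  rcases le_or_gt x 0 with hx | hx
  · filter_upwards with n
    rw [indicator_of_notMem (by simpa using hx), Real.smoothTransition.zero_of_nonpos]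
    exact mul_nonpos_of_nonneg_of_nonpos n.cast_nonneg hx
  · filter_upwards [(tendsto_natCast_atTop_atTop.atTop_mul_const hx).eventually_gt_atTop 1] with n hn
    rw [indicator_of_mem (by simpa using hx), Real.smoothTransition.one_of_one_le hn.le]
    rfl

/-- A line along which the velocity field is Lipschitz and which it is tangent to splits the mass
of the process in constant proportions. -/
theorem measureReal_line_lt_eq {S : ContProcess.{u}} {v : ℝ → ℝ → ℝ} {L p c s t : ℝ}
    (hv : IsConditionalVelocity S v) (hs : s ∈ Icc (0 : ℝ) 1) (ht : t ∈ Icc (0 : ℝ) 1)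
    (hL0 : 0 ≤ L) (hL : ∀ t ∈ Icc (0 : ℝ) 1, ∀ x, |v t x - c| ≤ L * |x - (p + c * t)|) :
    S.P.real {ω | p + c * t < S.X t ω} = S.P.real {ω | p + c * s < S.X s ω} := by
  obtain ⟨C, hC0, hC1, hC2⟩ := exists_bound_deriv_smoothTransition
  set μ := (volume.restrict (Icc (0 : ℝ) 1)).prod S.P
  let g : ℕ → ℝ → ℝ := fun n z => Real.smoothTransition (n * z)
  have hg : ∀ n, ContDiff ℝ 1 (g n) := fun n =>
    (Real.smoothTransition.contDiff (n := 1)).comp (contDiff_const.mul contDiff_id)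
  have hgd : ∀ n z, deriv (g n) z = n * deriv Real.smoothTransition (n * z) := fun n z => by
    simpa using deriv_comp_mul_left (n : ℝ) Real.smoothTransition z
  have hgz : ∀ n z, deriv (g n) z * z = deriv Real.smoothTransition (n * z) * (n * z) :=
    fun n z => by rw [hgd]; ring
  have hgK : ∀ n : ℕ, LipschitzWith (n * C.toNNReal) (g n) := fun n => by
    refine lipschitzWith_of_nnnorm_deriv_le ((hg n).differentiable one_ne_zero) fun z => ?_
    rw [← NNReal.coe_le_coe, coe_nnnorm, hgd, norm_mul]
    simpa [Real.coe_toNNReal _ hC0] using mul_le_mul_of_nonneg_left (hC1 _) n.cast_nonneg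
  have hgM : ∀ n z, |g n z| ≤ 1 := fun n z => by
    rw [abs_of_nonneg (Real.smoothTransition.nonneg _)]
    exact Real.smoothTransition.le_one _
  have hE : ∀ t ∈ Icc (0 : ℝ) 1, Tendsto (fun n => ∫ ω, g n (S.X t ω - (p + c * t)) ∂S.P) atTop
      (𝓝 (S.P.real {ω | p + c * t < S.X t ω})) := by
    intro t ht
    have hX : Measurable fun ω => S.X t ω - (p + c * t) := (S.measurable_X t ht).sub_const _
    have h1 : S.P.real {ω | p + c * t < S.X t ω} =
        ∫ ω, (Ioi (0 : ℝ)).indicator 1 (S.X t ω - (p + c * t)) ∂S.P := by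
      rw [← integral_indicator_one (measurableSet_lt measurable_const (S.measurable_X t ht))]
      refine integral_congr_ae (ae_of_all _ fun ω => ?_)
      simp [indicator]
    rw [h1]
    refine tendsto_integral_of_dominated_convergence (fun _ => 1) (fun n => ?_)
      (integrable_const 1) (fun n => ae_of_all _ fun ω => hgM n _)
      (ae_of_all _ fun ω => smoothTransition_mul_tendsto _)
    exact ((hg n).continuous.measurable.comp hX).aestronglyMeasurable
  -- The slope of the step grows like `n`, but the factor `z` compensates: the integrand is bounded
  -- by `C` and tends to 0 pointwise, including on the line itself.
  have hB : Tendsto (fun n => L * ∫ q : ℝ × S.Ω,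
      |deriv (g n) (S.X q.1 q.2 - (p + c * q.1)) * (S.X q.1 q.2 - (p + c * q.1))| ∂μ) atTop
      (𝓝 (L * ∫ _, (0 : ℝ) ∂μ)) := by
    refine Tendsto.const_mul L (tendsto_integral_of_dominated_convergence (fun _ => C) (fun n => ?_)
      (integrable_const C) (fun n => ae_of_all _ fun q => ?_) (ae_of_all _ fun q => ?_))
    · exact (integrable_comp_sub_line (C := C) (k := fun z => |deriv (g n) z * z|)
        (((hg n).continuous_deriv le_rfl).mul continuous_id).abs
        fun z => by rw [abs_abs, hgz]; exact hC2 _).aestronglyMeasurable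
    · rw [Real.norm_eq_abs, abs_abs, hgz]; exact hC2 _
    · simp_rw [hgz]; exact deriv_smoothTransition_mul_tendsto _
  rw [integral_zero, mul_zero] at hB
  have h0 := le_of_tendsto_of_tendsto ((hE t ht).sub (hE s hs)).abs hB
    (Eventually.of_forall fun n => abs_integral_sub_integral_le_of_mem_Icc hv hs ht hL0 hL (hg n)
      (hgK n) (hgM n) (C := C) fun z => by rw [hgz]; exact hC2 _)
  exact sub_eq_zero.1 (abs_nonpos_iff.1 h0)

/-! ### Geometry of the straight flow -/

/-- The flow lines of a flow without acceleration are straight. -/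
theorem exists_straight_flow {v φ : ℝ → ℝ → ℝ} (hφ : IsFlowMap v φ)
    (hacc : ∀ t ∈ Icc (0 : ℝ) 1, ∀ x : ℝ,
      HasDerivWithinAt (fun s => derivWithin (fun r => φ r x) (Icc 0 1) s) 0 (Icc 0 1) t) :
    ∃ c : ℝ → ℝ, ∀ t ∈ Icc (0 : ℝ) 1, ∀ x, v t (x + c x * t) = c x := by
  refine ⟨fun x => derivWithin (fun r => φ r x) (Icc 0 1) 0, fun t ht x => ?_⟩
  set D : ℝ → ℝ := fun s => derivWithin (fun r => φ r x) (Icc 0 1) s with hD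
  have hu : UniqueDiffOn ℝ (Icc (0 : ℝ) 1) := uniqueDiffOn_Icc_zero_one
  have hDc : ∀ s ∈ Icc (0 : ℝ) 1, D s = D 0 := constant_of_derivWithin_zero
    (fun s hs => (hacc s hs x).differentiableWithinAt)
    fun s hs => (hacc s (Ico_subset_Icc_self hs) x).derivWithin (hu s (Ico_subset_Icc_self hs))
  have hv : ∀ s ∈ Icc (0 : ℝ) 1, v s (φ s x) = D 0 := fun s hs => by
    rw [← hDc s hs]; exact ((hφ.ode s hs x).derivWithin (hu s hs)).symm
  have hline : ∀ s ∈ Icc (0 : ℝ) 1, φ s x - D 0 * s = φ 0 x - D 0 * 0 := by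
    have hd : ∀ s ∈ Icc (0 : ℝ) 1,
        HasDerivWithinAt (fun s => φ s x - D 0 * s) 0 (Icc 0 1) s := fun s hs => by
      have h1 := (hφ.ode s hs x).sub (((hasDerivWithinAt_id s (Icc 0 1)).const_mul (D 0)))
      rw [hv s hs, mul_one, sub_self] at h1
      exact h1
    exact constant_of_derivWithin_zero (fun s hs => (hd s hs).differentiableWithinAt)
      fun s hs => (hd s (Ico_subset_Icc_self hs)).derivWithin (hu s (Ico_subset_Icc_self hs))
  have h2 : φ t x = x + D 0 * t := by
    have := hline t ht
    rw [hφ.initial] at this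
    linarith
  rw [← h2]
  exact hv t ht

/-- Straight flow lines of a Lipschitz velocity field do not meet. -/
theorem straight_flow_lt {v : ℝ → ℝ → ℝ} {c : ℝ → ℝ} {L : ℝ}
    (hL : ∀ t ∈ Icc (0 : ℝ) 1, ∀ x y : ℝ, |v t x - v t y| ≤ L * |x - y|)
    (hc : ∀ t ∈ Icc (0 : ℝ) 1, ∀ x, v t (x + c x * t) = c x) {x y : ℝ} (hxy : x < y) :
    x + c x < y + c y := by
  by_contra! h
  -- The time at which the two lines would meet; there the Lipschitz bound forces equal slopes.
  set t : ℝ := (y - x) / (c x - c y)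
  have ht1 : (c x - c y) * t = y - x := by
    simp only [t]; field_simp [show c x - c y ≠ 0 by linarith]
  have ht : t ∈ Icc (0 : ℝ) 1 :=
    ⟨div_nonneg (by linarith) (by linarith), div_le_one_of_le₀ (by linarith) (by linarith)⟩
  have h1 := hL t ht (x + c x * t) (y + c y * t)
  rw [hc t ht, hc t ht, show x + c x * t - (y + c y * t) = 0 by linarith, abs_zero, mul_zero] at h1
  have := abs_nonpos_iff.1 h1
  linarith

theorem straight_flow_surjective {v : ℝ → ℝ → ℝ} {c : ℝ → ℝ} {L : ℝ} (hL0 : 0 ≤ L)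
    (hL : ∀ t ∈ Icc (0 : ℝ) 1, ∀ x y : ℝ, |v t x - v t y| ≤ L * |x - y|)
    (hc : ∀ t ∈ Icc (0 : ℝ) 1, ∀ x, v t (x + c x * t) = c x) :
    Function.Surjective fun x => x + c x := by
  have hc0 : ∀ x y, |c x - c y| ≤ L * |x - y| := fun x y => by
    have := hL 0 (by simp) x y
    have h0 := hc 0 (by simp)
    simp only [mul_zero, add_zero] at h0
    rwa [h0, h0] at this
  have hc1 : ∀ x y, |c x - c y| ≤ L * |x + c x - (y + c y)| := fun x y => by
    have := hL 1 (by simp) (x + c x) (y + c y)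
    have h0 := hc 1 (by simp)
    simp only [mul_one] at h0
    rwa [h0, h0] at this
  have hcont : Continuous c :=
    (LipschitzWith.of_dist_le_mul (K := L.toNNReal) fun x y => by
      rw [Real.coe_toNNReal _ hL0]; exact hc0 x y).continuous
  -- The Lipschitz bound at time 1 controls slopes by final positions, so the flow map contracts by
  -- at most a factor `1 + L` and is unbounded in both directions.
  have hgrow : ∀ x y, x ≤ y → y - x ≤ (1 + L) * (y + c y - (x + c x)) := fun x y hxy => by
    have h0 : x + c x ≤ y + c y := by
      rcases hxy.eq_or_lt with rfl | h
      · exact le_rfl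
      · exact (straight_flow_lt hL hc h).le
    have h1 := hc1 y x
    rw [abs_of_nonneg (by linarith : 0 ≤ y + c y - (x + c x))] at h1
    linarith [neg_abs_le (c y - c x)]
  refine Continuous.surjective (by fun_prop) ?_ ?_
  · refine tendsto_atTop_mono' atTop (f₁ := fun x => x / (1 + L) + c 0) ?_ ?_
    · filter_upwards [eventually_ge_atTop 0] with x hx
      have := hgrow 0 x hx
      have h2 : x / (1 + L) ≤ x + c x - c 0 := by
        rw [div_le_iff₀ (by linarith)]; linarith
      linarith
    · exact tendsto_atTop_add_const_right _ _ (tendsto_id.atTop_div_const (by linarith))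
  · refine tendsto_atBot_mono' atBot (f₁ := fun x => x / (1 + L) + c 0) ?_ ?_
    · filter_upwards [eventually_le_atBot 0] with x hx
      have := hgrow x 0 hx
      have h2 : x + c x - c 0 ≤ x / (1 + L) := by
        rw [le_div_iff₀ (by linarith)]; linarith
      linarith
    · exact tendsto_atBot_add_const_right _ _ (tendsto_id.atBot_div_const (by linarith))

/-! ### Crossing paths on a time grid -/

/-- A path that starts well below a moving line and ends above it, and whose modulus of continuity
is small at the scales `h` and `1 / N`, is just below the line at one of the times `k / N`. -/
theorem exists_grid_time_near_line {X : ℝ → ℝ} {x c h ρ κ : ℝ} {N : ℕ} (hN : 0 < N)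
    (hκ : 0 < κ) (hρ : 4 * κ ≤ ρ) (hch : |c| * h ≤ ρ / 4) (hcN : |c| / N ≤ κ / 2)
    (h0 : X 0 ≤ x - ρ) (h1 : x + c < X 1)
    (hmh : ∀ t ∈ Icc (0 : ℝ) 1, |t - 0| ≤ h → |X t - X 0| < ρ / 2)
    (hmN : ∀ s ∈ Icc (0 : ℝ) 1, ∀ t ∈ Icc (0 : ℝ) 1, |t - s| ≤ 1 / N → |X t - X s| < κ / 2) :
    ∃ k ∈ Finset.range (N + 1), h < (k : ℝ) / N ∧ x + c * (k / N) - κ < X (k / N) ∧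
      X (k / N) ≤ x + c * (k / N) := by
  classical
  have hN' : (0 : ℝ) < N := Nat.cast_pos.2 hN
  -- The first grid time above the line lowered by `κ` is the one wanted. One grid step earlier the
  -- path was still below; in one step the path rises by less than `κ / 2` and the line drops by at
  -- most `κ / 2`, so the path cannot pass the line.
  have hex : ∃ k : ℕ, x + c * (k / N) - κ < X (k / N) :=
    ⟨N, by rw [div_self hN'.ne', mul_one]; linarith⟩
  have hkN : Nat.find hex ≤ N :=
    Nat.find_min' hex (by rw [div_self hN'.ne', mul_one]; linarith)
  have hk := Nat.find_spec hex
  have hmin := fun m => Nat.find_min hex (m := m)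
  generalize Nat.find hex = k at hkN hk hmin
  have hmem : ∀ m ≤ N, (m : ℝ) / N ∈ Icc (0 : ℝ) 1 := fun m hm =>
    ⟨by positivity, div_le_one_of_le₀ (by exact_mod_cast hm) hN'.le⟩
  have hlt : h < (k : ℝ) / N := by
    by_contra! hle
    have h2 := hmh _ (hmem k hkN) (by rwa [sub_zero, abs_of_nonneg (hmem k hkN).1])
    have h3 : |c * ((k : ℝ) / N)| ≤ ρ / 4 := by
      rw [abs_mul, abs_of_nonneg (hmem k hkN).1]
      exact (mul_le_mul_of_nonneg_left hle (abs_nonneg c)).trans hch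
    linarith [(abs_lt.1 h2).2, (abs_le.1 h3).1]
  refine ⟨k, Finset.mem_range.2 (by omega), hlt, hk, ?_⟩
  have hk0 : k ≠ 0 := by
    rintro rfl
    simp only [Nat.cast_zero, zero_div, mul_zero, add_zero] at hk
    linarith
  obtain ⟨j, rfl⟩ := Nat.exists_eq_succ_of_ne_zero hk0
  have hj := not_lt.1 (hmin j (Nat.lt_succ_self j))
  have hdiff : ((j.succ : ℕ) : ℝ) / N - (j : ℝ) / N = 1 / N := by push_cast; ring
  have h2 := hmN _ (hmem j (by omega)) _ (hmem j.succ hkN)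
    (by rw [hdiff, abs_of_nonneg (by positivity)])
  have h3 : c * (((j.succ : ℕ) : ℝ) / N) = c * ((j : ℝ) / N) + c / N := by
    rw [← sub_eq_iff_eq_add', ← mul_sub, hdiff]; ring
  have h4 : |c / N| ≤ κ / 2 := by rwa [abs_div, abs_of_pos hN']
  linarith [(abs_lt.1 h2).2, (abs_le.1 h4).1]

theorem abs_sub_lt_of_modulus_lt {S : ContProcess.{u}} {ω : S.Ω} {δ θ s t : ℝ}
    (h : ¬ ENNReal.ofReal θ ≤ S.modulus δ ω) (hs : s ∈ Icc (0 : ℝ) 1) (ht : t ∈ Icc (0 : ℝ) 1)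
    (hst : |t - s| ≤ δ) : |S.X t ω - S.X s ω| < θ := by
  have h1 : ENNReal.ofReal |S.X t ω - S.X s ω| ≤ S.modulus δ ω :=
    le_iSup₂_of_le t ht (le_iSup₂_of_le s hs (le_iSup_of_le hst le_rfl))
  exact (ENNReal.ofReal_lt_ofReal_iff_of_nonneg (abs_nonneg _)).1 (h1.trans_lt (not_le.1 h))

/-! ### Gaussian estimates and the endpoint law -/

theorem gaussianReal_real_tail_le (m s : ℝ) {r : ℝ} (hr : 0 < r) :
    (gaussianReal m (Real.toNNReal (s ^ 2))).real {x | r ≤ |x - m|} ≤ s ^ 2 / r ^ 2 := by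
  have h := meas_ge_le_variance_div_sq
    (memLp_id_gaussianReal (μ := m) (v := Real.toNNReal (s ^ 2)) 2) hr
  rw [variance_id_gaussianReal] at h
  simp only [id, integral_id_gaussianReal, Real.coe_toNNReal _ (sq_nonneg s)] at h
  exact ENNReal.toReal_le_of_le_ofReal (by positivity) h

theorem gaussianReal_zero_one_real_Ioc_le (a : ℝ) {r : ℝ} (hr : 0 ≤ r) :
    (gaussianReal 0 1).real (Ioc (a - r) a) ≤ r := by
  refine ENNReal.toReal_le_of_le_ofReal hr ?_
  rw [gaussianReal_apply 0 one_ne_zero]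
  calc ∫⁻ x in Ioc (a - r) a, gaussianPDF 0 1 x ≤ ∫⁻ _ in Ioc (a - r) a, 1 := by
        refine lintegral_mono fun x => ENNReal.ofReal_le_one.2 ?_
        rw [gaussianPDFReal]
        refine mul_le_one₀ (inv_le_one_of_one_le₀ ?_) (Real.exp_pos _).le
          (Real.exp_le_one_iff.2 ?_)
        · rw [NNReal.coe_one, mul_one]
          exact Real.one_le_sqrt.2 (by linarith [Real.pi_gt_three])
        · rw [neg_div]
          exact neg_nonpos.2 (by positivity)
    _ = ENNReal.ofReal r := by simp

theorem measureReal_endpoints {S : ContProcess.{u}} {P₀ P₁ : Measure ℝ} [SFinite P₁]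
    (hS : S ∈ IndepEndpoints P₀ P₁) {s t : Set ℝ} (hs : MeasurableSet s) (ht : MeasurableSet t) :
    S.P.real {ω | S.X 0 ω ∈ s ∧ S.X 1 ω ∈ t} = P₀.real s * P₁.real t := by
  have hm : Measurable fun ω => (S.X 0 ω, S.X 1 ω) :=
    (S.measurable_X 0 (by simp)).prodMk (S.measurable_X 1 (by simp))
  have h : S.P {ω | S.X 0 ω ∈ s ∧ S.X 1 ω ∈ t} = P₀ s * P₁ t := by
    rw [← Measure.prod_prod, ← show _ = _ from hS, Measure.map_apply hm (hs.prod ht)]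
    rfl
  rw [measureReal_def, h, ENNReal.toReal_mul, measureReal_def, measureReal_def]

/-! ### The contradiction -/

/-- The straight-line and the concentration property are incompatible if the target puts mass at
least `q` on both sides of `m`, but very little just below `m`. -/
theorem not_mem_concentrationClass {S : ContProcess.{u}} {P₁ : Measure ℝ} [IsProbabilityMeasure P₁]
    (hS : S ∈ StraightLineProcesses (gaussianReal 0 1) P₁) {A α β m d q R h κ : ℝ} {N : ℕ}
    (hd : 0 < d) (hq : 0 < q) (hqI : q ≤ P₁.real (Iic m)) (hqJ : q ≤ P₁.real (Ioi m))
    (hR : (gaussianReal 0 1).real {x | R ≤ |x - 0|} < q) (hh : 0 < h) (hh1 : (|m| + R) * h ≤ q / 8)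
    (hhA : A * h ^ α / (q / 4) ^ β ≤ q ^ 2 / 8) (hκ : 0 < κ) (hκq : κ ≤ q / 8) (hκh : κ ≤ h * d)
    (hN : 0 < N) (hN1 : (|m| + R) / N ≤ κ / 2)
    (hNA : A * (1 / N : ℝ) ^ α / (κ / 2) ^ β ≤ q ^ 2 / 8)
    (hgap : P₁.real (Ioc (m - d) m) ≤ q ^ 2 / (8 * (N + 1))) :
    S ∉ ConcentrationClass A α β := by
  intro hconc
  obtain ⟨hend, v, φ, hv, -, ⟨L, hL0, hL⟩, hφ, hacc⟩ := hS
  obtain ⟨c, hc⟩ := exists_straight_flow hφ hacc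
  have hsurj := straight_flow_surjective hL0.le hL hc
  obtain ⟨x, hx⟩ := hsurj m
  obtain ⟨y, hy⟩ := hsurj (m - d)
  simp only at hx hy
  have hyx : y < x := by
    by_contra! hle
    rcases hle.eq_or_lt with rfl | hlt
    · linarith
    · linarith [straight_flow_lt hL hc hlt]
  have h01 : (0 : ℝ) ∈ Icc (0 : ℝ) 1 := by simp
  have h11 : (1 : ℝ) ∈ Icc (0 : ℝ) 1 := by simp
  have hconst : ∀ z, ∀ s ∈ Icc (0 : ℝ) 1, ∀ t ∈ Icc (0 : ℝ) 1,
      S.P.real {ω | z + c z * t < S.X t ω} = S.P.real {ω | z + c z * s < S.X s ω} :=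
    fun z s hs t ht => measureReal_line_lt_eq hv hs ht hL0.le fun r hr w => by
      have := hL r hr w (z + c z * r)
      rwa [hc r hr] at this
  have hm0 : ∀ s : Set ℝ, MeasurableSet s →
      S.P.real {ω | S.X 0 ω ∈ s} = (gaussianReal 0 1).real s := fun s hs => by
    simpa using measureReal_endpoints hend hs MeasurableSet.univ
  have hm1 : ∀ s : Set ℝ, MeasurableSet s → S.P.real {ω | S.X 1 ω ∈ s} = P₁.real s := fun s hs => by
    simpa using measureReal_endpoints hend MeasurableSet.univ hs
  -- the line of `x` splits the source and the target in the same proportions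
  have hxJ : (gaussianReal 0 1).real (Ioi x) = P₁.real (Ioi m) := by
    rw [← hm0 _ measurableSet_Ioi, ← hm1 _ measurableSet_Ioi, ← hx]
    simpa using (hconst x 0 h01 1 h11).symm
  have hxI : (gaussianReal 0 1).real (Iic x) = P₁.real (Iic m) := by
    rw [← compl_Ioi, ← compl_Ioi, measureReal_compl measurableSet_Ioi,
      measureReal_compl measurableSet_Ioi, hxJ]
    simp
  -- Both sides of `x` have Gaussian mass at least `q`, so `x` is not in the tail; this bounds the
  -- slope `c x` by a number free of the variances.
  have hxR : |x| < R := by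
    by_contra! hle
    rcases le_or_gt 0 x with h0 | h0
    · rw [abs_of_nonneg h0] at hle
      have : (gaussianReal 0 1).real (Ioi x) ≤ (gaussianReal 0 1).real {x | R ≤ |x - 0|} :=
        measureReal_mono fun z (hz : x < z) => by
          simp only [mem_ofPred_eq, sub_zero]; linarith [le_abs_self z]
      linarith
    · rw [abs_of_neg h0] at hle
      have : (gaussianReal 0 1).real (Iic x) ≤ (gaussianReal 0 1).real {x | R ≤ |x - 0|} :=
        measureReal_mono fun z (hz : z ≤ x) => by
          simp only [mem_ofPred_eq, sub_zero]; linarith [neg_abs_le z]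
      linarith
  have hcx : |c x| ≤ |m| + R := by
    rw [show c x = m - x by linarith]
    exact (abs_sub m x).trans (by linarith)
  -- the gap below the line of `x` carries little mass at all times
  set G : ℝ → Set S.Ω := fun t => {ω | y + c y * t < S.X t ω} \ {ω | x + c x * t < S.X t ω}
  -- The distance of the lines is `(1 - t) * (x - y) + t * d`.
  have hline : ∀ t ∈ Icc (0 : ℝ) 1, y + c y * t ≤ x + c x * t - t * d := fun t ht => by
    have : 0 ≤ (1 - t) * (x - y) := mul_nonneg (by linarith [ht.2]) (by linarith)
    have h1 : c x = m - x := by linarith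
    have h2 : c y = m - d - y := by linarith
    rw [h1, h2]; nlinarith
  have hGu : ∀ t ∈ Icc (0 : ℝ) 1, S.P.real (G t) =
      S.P.real {ω | y + c y * t < S.X t ω} - S.P.real {ω | x + c x * t < S.X t ω} := fun t ht => by
    refine measureReal_sdiff (fun ω (hω : x + c x * t < S.X t ω) =>
      show y + c y * t < S.X t ω from lt_of_le_of_lt ?_ hω)
      (measurableSet_lt measurable_const (S.measurable_X t ht))
    linarith [hline t ht, mul_nonneg ht.1 hd.le]
  have hG : ∀ t ∈ Icc (0 : ℝ) 1, S.P.real (G t) ≤ q ^ 2 / (8 * (N + 1)) := fun t ht => by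
    have h1 : S.P.real (G 1) = P₁.real (Ioc (m - d) m) := by
      rw [← hm1 _ measurableSet_Ioc]
      congr 1
      ext ω
      simp [G, hx, hy]
    rw [hGu t ht, hconst y 1 h11 t ht, hconst x 1 h11 t ht, ← hGu 1 h11, h1]
    exact hgap
  set E : Set S.Ω := {ω | S.X 0 ω ∈ Iic (x - q / 2) ∧ S.X 1 ω ∈ Ioi m} with hE
  -- The standard Gaussian density is at most 1, so lowering the threshold by `q / 2` costs at most
  -- mass `q / 2`.
  have hEle : q / 2 * q ≤ S.P.real E := by
    rw [hE, measureReal_endpoints hend measurableSet_Iic measurableSet_Ioi]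
    refine mul_le_mul ?_ hqJ hq.le measureReal_nonneg
    have h1 := measureReal_union_le (μ := gaussianReal 0 1) (Iic (x - q / 2)) (Ioc (x - q / 2) x)
    rw [Iic_union_Ioc_eq_Iic (by linarith), hxI] at h1
    linarith [gaussianReal_zero_one_real_Ioc_le x (half_pos hq).le]
  have hcover : E ⊆ ({ω | ENNReal.ofReal (q / 4) ≤ S.modulus h ω} ∪
      {ω | ENNReal.ofReal (κ / 2) ≤ S.modulus (1 / N) ω}) ∪
        ⋃ k ∈ Finset.range (N + 1), G ((k : ℝ) / N) := by
    intro ω hω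
    by_contra hnot
    simp only [mem_union, not_or, mem_ofPred_eq] at hnot
    obtain ⟨⟨hn1, hn2⟩, hn3⟩ := hnot
    obtain ⟨k, hk, hk1, hk2, hk3⟩ := exists_grid_time_near_line (X := fun t => S.X t ω) (x := x)
      (c := c x) (ρ := q / 2) hN hκ (by linarith)
      ((mul_le_mul_of_nonneg_right hcx hh.le).trans (by linarith))
      ((div_le_div_of_nonneg_right hcx N.cast_nonneg).trans hN1) hω.1 (by rw [hx]; exact hω.2)
      (fun t ht hth => (abs_sub_lt_of_modulus_lt hn1 h01 ht hth).trans_le (by linarith))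
      (fun s hs t ht hst => abs_sub_lt_of_modulus_lt hn2 hs ht hst)
    have hkN : (k : ℝ) / N ∈ Icc (0 : ℝ) 1 := ⟨by positivity, div_le_one_of_le₀
      (by exact_mod_cast Nat.lt_succ_iff.1 (Finset.mem_range.1 hk)) N.cast_nonneg⟩
    refine hn3 (mem_iUnion₂.2 ⟨k, hk, lt_of_le_of_lt ?_ hk2, not_lt.2 hk3⟩)
    have := mul_le_mul_of_nonneg_right hk1.le hd.le
    linarith [hline _ hkN]
  have hmod : ∀ θ δ : ℝ, 0 < θ → 0 < δ → A * δ ^ α / θ ^ β ≤ q ^ 2 / 8 →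
      S.P.real {ω | ENNReal.ofReal θ ≤ S.modulus δ ω} ≤ q ^ 2 / 8 := fun θ δ hθ hδ hle =>
    ENNReal.toReal_le_of_le_ofReal (by positivity)
      ((hconc θ δ hθ hδ).trans (ENNReal.ofReal_le_ofReal hle))
  have hsum : S.P.real (⋃ k ∈ Finset.range (N + 1), G ((k : ℝ) / N)) ≤ q ^ 2 / 8 := by
    refine (measureReal_biUnion_finset_le _ _).trans ?_
    refine (Finset.sum_le_card_nsmul _ _ (q ^ 2 / (8 * (N + 1))) fun k hk => hG _ ?_).trans ?_
    · exact ⟨by positivity, div_le_one_of_le₀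
        (by exact_mod_cast Nat.lt_succ_iff.1 (Finset.mem_range.1 hk)) N.cast_nonneg⟩
    · rw [Finset.card_range, nsmul_eq_mul]
      push_cast
      exact le_of_eq (by field_simp)
  have hfin := (measureReal_mono hcover (measure_ne_top S.P _)).trans
    ((measureReal_union_le _ _).trans (add_le_add (measureReal_union_le _ _) le_rfl))
  have h1 := hmod _ _ (by positivity) hh hhA
  have h2 := hmod _ _ (half_pos hκ) (by positivity) hNA
  -- The three parts of the cover have mass at most `3 * q ^ 2 / 8` in total, less than `q ^ 2 / 2`.
  nlinarith [pow_pos hq 2]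

/-! ### Choice of the constants for the mixture -/

theorem eventually_rpow_mul_div_le {A α D ε ε' K : ℝ} (hα : 0 < α) (hε : 0 < ε) (hε' : 0 < ε') :
    ∀ᶠ h in 𝓝 (0 : ℝ), A * h ^ α / D ≤ ε ∧ K * h ≤ ε' := by
  have h1 : Tendsto (fun h : ℝ => A * h ^ α / D) (𝓝 0) (𝓝 0) := by
    have : Continuous fun h : ℝ => A * h ^ α / D :=
      ((Real.continuous_rpow_const hα.le).const_mul A).div_const D
    simpa [Real.zero_rpow hα.ne'] using this.tendsto 0
  have h2 : Tendsto (fun h : ℝ => K * h) (𝓝 0) (𝓝 0) := by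
    simpa using (continuous_const_mul K).tendsto 0
  exact (h1.eventually_le_const hε).and (h2.eventually_le_const hε')

theorem gaussianMixture_real {w₀ w₁ : ℝ} (hw₀ : 0 ≤ w₀) (hw₁ : 0 ≤ w₁) (m₀ m₁ σ₀ σ₁ : ℝ)
    (s : Set ℝ) :
    (gaussianMixture w₀ w₁ m₀ m₁ σ₀ σ₁).real s =
      w₀ * (gaussianReal m₀ (Real.toNNReal (σ₀ ^ 2))).real s +
        w₁ * (gaussianReal m₁ (Real.toNNReal (σ₁ ^ 2))).real s := by
  rw [gaussianMixture, measureReal_add_apply (ENNReal.mul_ne_top ENNReal.ofReal_ne_top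
    (measure_ne_top _ _)) (ENNReal.mul_ne_top ENNReal.ofReal_ne_top (measure_ne_top _ _)),
    measureReal_ennreal_smul_apply,
    measureReal_ennreal_smul_apply, ENNReal.toReal_ofReal hw₀, ENNReal.toReal_ofReal hw₁]

theorem isProbabilityMeasure_gaussianMixture {w₀ w₁ : ℝ} (hw₀ : 0 ≤ w₀) (hw₁ : 0 ≤ w₁)
    (hw : w₀ + w₁ = 1) (m₀ m₁ σ₀ σ₁ : ℝ) :
    IsProbabilityMeasure (gaussianMixture w₀ w₁ m₀ m₁ σ₀ σ₁) := by
  constructor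
  simp [gaussianMixture, ← ENNReal.ofReal_add hw₀ hw₁, hw]

theorem gaussianMixture_comm (w₀ w₁ m₀ m₁ σ₀ σ₁ : ℝ) :
    gaussianMixture w₀ w₁ m₀ m₁ σ₀ σ₁ = gaussianMixture w₁ w₀ m₁ m₀ σ₁ σ₀ :=
  add_comm _ _

theorem exists_inter_eq_empty_of_lt {w₀ w₁ A α β m₀ m₁ : ℝ} (hw₀ : 0 < w₀) (hw₁ : 0 < w₁)
    (hw : w₀ + w₁ = 1) (hα : 0 < α) (hm : m₀ < m₁) :
    ∃ σ : ℝ, 0 < σ ∧ ∀ σ₀ σ₁ : ℝ, 0 < σ₀ → σ₀ ≤ σ → 0 < σ₁ → σ₁ ≤ σ →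
      StraightLineProcesses.{u} (gaussianReal 0 1) (gaussianMixture w₀ w₁ m₀ m₁ σ₀ σ₁) ∩
        ConcentrationClass.{u} A α β = ∅ := by
  -- With `m` the midpoint of the means, `(m - d, m]` is at distance at least `d` from both.
  obtain ⟨d, hd, rfl⟩ : ∃ d, 0 < d ∧ m₁ = m₀ + 4 * d := ⟨(m₁ - m₀) / 4, by linarith, by ring⟩
  set m := m₀ + 2 * d with hmdef
  -- Each component will keep at least half of its weight on its own side of `m`.
  obtain ⟨q, hq, hq0, hq1⟩ : ∃ q : ℝ, 0 < q ∧ q ≤ w₀ / 2 ∧ q ≤ w₁ / 2 :=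
    ⟨min (w₀ / 2) (w₁ / 2), by positivity, min_le_left _ _, min_le_right _ _⟩
  have hR : (gaussianReal 0 1).real {x | 1 / q ≤ |x - 0|} < q := by
    have h1 := gaussianReal_real_tail_le 0 1 (r := 1 / q) (by positivity)
    rw [one_pow, Real.toNNReal_one] at h1
    refine h1.trans_lt ?_
    rw [one_div_pow, one_div_one_div]
    nlinarith
  set K := |m| + 1 / q
  obtain ⟨h, ⟨hhA, hhK⟩, hh⟩ := (((eventually_rpow_mul_div_le (A := A) (D := (q / 4) ^ β) (K := K) hα
    (show 0 < q ^ 2 / 8 by positivity) (show 0 < q / 8 by positivity)).filter_mono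
      nhdsWithin_le_nhds).and (self_mem_nhdsWithin (s := Ioi (0 : ℝ)))).exists
  have hh0 : 0 < h := hh
  set κ := min (q / 8) (h * d)
  have hκ : 0 < κ := by positivity
  obtain ⟨N, ⟨hNA, hNK⟩, hN⟩ := ((tendsto_one_div_atTop_nhds_zero_nat.eventually
    (eventually_rpow_mul_div_le (A := A) (D := (κ / 2) ^ β) (K := K) hα
      (show 0 < q ^ 2 / 8 by positivity) (half_pos hκ))).and (eventually_gt_atTop 0)).exists
  set τ := min (1 / 2) (q ^ 2 / (8 * ((N : ℝ) + 1)))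
  have hτ : 0 < τ := by positivity
  -- Chebyshev's bound `s ^ 2 / d ^ 2` is then at most `τ`, which serves both for the mass near the
  -- means and for the gap.
  refine ⟨d * √τ, by positivity, fun σ₀ σ₁ h0 h0' h1 h1' => ?_⟩
  have := isProbabilityMeasure_gaussianMixture hw₀.le hw₁.le hw m₀ (m₀ + 4 * d) σ₀ σ₁
  have htail : ∀ a s : ℝ, 0 < s → s ≤ d * √τ →
      (gaussianReal a (Real.toNNReal (s ^ 2))).real {x | d ≤ |x - a|} ≤ τ := fun a s hs hs' => by
    refine (gaussianReal_real_tail_le a s hd).trans ?_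
    rw [div_le_iff₀ (by positivity)]
    calc s ^ 2 ≤ (d * √τ) ^ 2 := pow_le_pow_left₀ hs.le hs' 2
      _ = τ * d ^ 2 := by rw [mul_pow, Real.sq_sqrt hτ.le, mul_comm]
  have hcentre : ∀ a s : ℝ, 0 < s → s ≤ d * √τ → ∀ T : Set ℝ,
      (∀ z, |z - a| < d → z ∈ T) → 1 / 2 ≤ (gaussianReal a (Real.toNNReal (s ^ 2))).real T :=
    fun a s hs hs' T hT => by
      refine le_trans ?_ (measureReal_mono (s₁ := {x | d ≤ |x - a|}ᶜ) fun z hz => hT z (by simpa using hz))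
      rw [measureReal_compl (measurableSet_le measurable_const (by fun_prop))]
      have := htail a s hs hs'
      have h2 : τ ≤ 1 / 2 := min_le_left _ _
      simp only [probReal_univ]
      linarith
  refine eq_empty_of_forall_notMem fun S hS => not_mem_concentrationClass (R := 1 / q) (h := h)
    (m := m) hS.1 hd hq ?_ ?_ hR hh0 hhK hhA hκ (min_le_left _ _) (min_le_right _ _) hN ?_ hNA ?_ hS.2
  · rw [gaussianMixture_real hw₀.le hw₁.le]
    have h2 := hcentre m₀ σ₀ h0 h0' (Iic m) fun z hz => by
      have := (abs_lt.1 hz).2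
      simp only [mem_Iic]; linarith
    have h3 := mul_nonneg hw₁.le (measureReal_nonneg
      (μ := gaussianReal (m₀ + 4 * d) (Real.toNNReal (σ₁ ^ 2))) (s := Iic m))
    nlinarith
  · rw [gaussianMixture_real hw₀.le hw₁.le]
    have h2 := hcentre (m₀ + 4 * d) σ₁ h1 h1' (Ioi m) fun z hz => by
      have := (abs_lt.1 hz).1
      simp only [mem_Ioi]; linarith
    have h3 := mul_nonneg hw₀.le (measureReal_nonneg
      (μ := gaussianReal m₀ (Real.toNNReal (σ₀ ^ 2))) (s := Ioi m))
    nlinarith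
  · rwa [mul_one_div] at hNK
  · have hτ' : τ ≤ q ^ 2 / (8 * ((N : ℝ) + 1)) := min_le_right _ _
    refine le_trans ?_ hτ'
    rw [gaussianMixture_real hw₀.le hw₁.le]
    have h2 : (gaussianReal m₀ (Real.toNNReal (σ₀ ^ 2))).real (Ioc (m - d) m) ≤ τ :=
      (measureReal_mono fun z hz => by
        have := hz.1
        simp only [mem_ofPred_eq]; linarith [le_abs_self (z - m₀)]).trans (htail m₀ σ₀ h0 h0')
    have h3 : (gaussianReal (m₀ + 4 * d) (Real.toNNReal (σ₁ ^ 2))).real (Ioc (m - d) m) ≤ τ :=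
      (measureReal_mono fun z hz => by
        have := hz.2
        simp only [mem_ofPred_eq]; linarith [neg_abs_le (z - (m₀ + 4 * d))]).trans
          (htail _ σ₁ h1 h1')
    calc _ ≤ w₀ * τ + w₁ * τ := by gcongr
      _ = τ := by rw [← add_mul, hw, one_mul]

end StraightLine

theorem mainTheorem9 (w₀ w₁ : ℝ) (hw₀ : 0 < w₀) (hw₁ : 0 < w₁) (hw : w₀ + w₁ = 1)
    (A α β : ℝ) (hA : 0 < A) (hα : 0 < α) (hβ : 0 < β)
    (m₀ m₁ : ℝ) (hm : m₀ ≠ m₁) :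
    ∃ σ : ℝ, 0 < σ ∧ ∀ σ₀ σ₁ : ℝ, 0 < σ₀ → σ₀ ≤ σ → 0 < σ₁ → σ₁ ≤ σ →
      StraightLine.StraightLineProcesses.{u} (gaussianReal 0 1)
          (StraightLine.gaussianMixture w₀ w₁ m₀ m₁ σ₀ σ₁) ∩
        StraightLine.ConcentrationClass.{u} A α β = ∅ := by
  rcases lt_or_gt_of_ne hm with h | h
  · exact StraightLine.exists_inter_eq_empty_of_lt hw₀ hw₁ hw hα h
  · obtain ⟨σ, hσ, H⟩ := StraightLine.exists_inter_eq_empty_of_lt (A := A) (β := β) hw₁ hw₀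
      (by rwa [add_comm]) hα h
    refine ⟨σ, hσ, fun σ₀ σ₁ h0 h0' h1 h1' => ?_⟩
    rw [StraightLine.gaussianMixture_comm]
    exact H σ₁ σ₀ h1 h1' h0 h0'
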